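/- **Model.** A sender and a receiver are connected by $n$ channels and have no other means of communication (no public channel). A protocol $\Pi$ with finite non-empty message space $\mathcal M$ has a fixed number of rounds; in each round the party scheduled to speak (sender or receiver) sends, on each channel, a packet (possibly empty, possibly containing the special message DETECT) depending on its private random coins, on what it has received so far and, for the sender, on the message $M_S\in\mathcal M$ to be transmitted. At the end the receiver outputs $M_R\in\mathcal M$ or nothing. A $t$-adversary uses its own random coins to choose at most $t$ channels to corrupt; in every round, after seeing what is sent on the corrupted channels, it replaces the packets on them by packets of its choice; at the end it outputs some $M_A\in\mathcal M$. It is computationally unbounded, and the coins of the three are independent. $\Pi$ is $(0,0)$-SMT against an adversary $\mathcal B$ if (correctness) for every $m$, whenever $\mathcal B$ changes no messages, $\Pr[M_R=m]=1$ for $M_S=m$; (privacy) for all $m_0,m_1\in\mathcal M$ and all fixed coins of $\mathcal B$, the sequences of packets sent over the corrupted channels for $M_S=m_0$ and for $M_S=m_1$ have statistical distance $0$; (reliability) for every $m$, $\Pr[M_R\ne m]=0$ for $M_S=m$. In the SMT game, $M_S$ is uniformly random in $\mathcal M$ and $\Pi$ is run with the adversary. Put $\mathsf{guess}=1$ iff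 $M_A=M_S$; $\mathsf{suc}=1$ iff $M_R=M_S$; $\mathsf{detect}=1$ iff the sender or the receiver sends DETECT at some time (and $0$ otherwise). For $U:\{0,1\}^3\to\mathbb R$ let $u(\mathcal A,U)=\mathbb E[U(\mathsf{guess},\mathsf{suc},\mathsf{detect})]$. $\Pi$ is perfectly secure against a rational $t$-adversary with utility function $U$ if there is a $t$-adversary $\mathcal B$ such that $\Pi$ is $(0,0)$-SMT against $\mathcal B$ and $u(\mathcal A,U)\le u(\mathcal B,U)$ for every $t$-adversary $\mathcal A$. $U$ is timid if $U(g,0,d)>U(g,1,d)$ and $U(g,s,0)>U(g,s,1)$ for all $g,s,d\in\{0,1\}$. For $s,d\in\{0,1\}$ let $w_{s,d}=\frac1{|\mathcal M|}U(1,s,d)+\bigl(1-\frac1{|\mathcal M|}\bigr)U(0,s,d)$, and put $u_2=w_{1,0}$, $u_3=w_{0,1}$, $u_4=w_{1,1}$. **Theorem.** Let $\Pi$ be a protocol as above (without public channel) that is perfectly secure against a rational $t$-adversary with a timid utility function $U$ such that $u_4\ge 0$. If $$u_2<\frac12\Bigl(1-\frac1{|\mathcal M|}\Bigr)u_3,$$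 then $t<n/2$. -/

import Mathlib

namespace SMT

/-- The two honest parties. -/
inductive Party where
  | sender
  | receiver
  deriving DecidableEq

/-- What travels over one channel in one round: an optional payload (`none` is the empty or
blocked transmission) and possibly the special message "DETECT" sent along with it. -/
structure Packet (Msg : Type) where
  payload : Option Msg
  detect : Bool

/-- The contents of all `n` channels in one round. -/
abbrev Row (n : ℕ) (Msg : Type) : Type := Fin n → Packet Msg

/-- One round of an execution: who speaks, what that party puts on the channels, and what
arrives at the other end. -/
structure Exchange (n : ℕ) (Msg : Type) where
  speaker : Party
  sent : Row n Msg
  delivered : Row n Msg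

/-- What party `p` has received so far: the rows delivered in the rounds in which the other
party was speaking, in chronological order. -/
def heard {n : ℕ} {Msg : Type} (p : Party) (T : List (Exchange n Msg)) : List (Row n Msg) :=
  (T.filter fun e => e.speaker ≠ p).map fun e => e.delivered

/-- A protocol (with message space `M`, over `n` channels carrying packets over `Msg`) between a
sender and a receiver who have no other means of communication; in particular there is no public
channel. The private random coins of the parties have arbitrary discrete distributions. In each
round (numbered from `0`) the scheduled speaker sends packets which depend on its coins, the
round number, the rows it received earlier, and, for the sender, the message to be transmitted.
At the end, the receiver outputs a message, or nothing (`none`). -/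
structure Protocol (M Msg : Type) (n : ℕ) where
  rounds : ℕ
  speaker : ℕ → Party
  SCoin : Type
  sCoin : PMF SCoin
  RCoin : Type
  rCoin : PMF RCoin
  sSend : M → SCoin → ℕ → List (Row n Msg) → Row n Msg
  rSend : RCoin → ℕ → List (Row n Msg) → Row n Msg
  output : RCoin → List (Row n Msg) → Option M

/-- What an adversary sees of a round: the packets sent over the corrupted channels
(`none` at the other channels). -/
abbrev Glimpse (n : ℕ) (Msg : Type) : Type := Fin n → Option (Packet Msg)

/-- The restriction of a row to a set of channels. -/
def glimpse {n : ℕ} {Msg : Type} (I : Finset (Fin n)) (x : Row n Msg) : Glimpse n Msg :=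
  fun i => if i ∈ I then some (x i) else none

/-- A computationally unbounded rushing `t`-adversary. From its random coins it chooses at most
`t` channels to corrupt. In each round, given what was sent over the corrupted channels up to and
including this round, it decides by `tamper` what arrives on them (the values of `tamper` at other
channels are never used). At the end it outputs a guess of the transmitted message. -/
structure Adversary (M Msg : Type) (n t : ℕ) where
  Coin : Type
  coin : PMF Coin
  corrupt : Coin → Finset (Fin n)
  card_corrupt_le : ∀ r, (corrupt r).card ≤ t
  tamper : Coin → List (Glimpse n Msg) → Row n Msg
  guess : Coin → List (Glimpse n Msg) → M

section Execution

variable {M Msg : Type} {n t : ℕ}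

/-- What the speaker of round `j` sends, after the execution `T` of the earlier rounds. -/
def Protocol.send (P : Protocol M Msg n) (m : M) (rS : P.SCoin) (rR : P.RCoin) (j : ℕ)
    (T : List (Exchange n Msg)) : Row n Msg :=
  match P.speaker j with
  | .sender => P.sSend m rS j (heard .sender T)
  | .receiver => P.rSend rR j (heard .receiver T)

/-- The messages sent over the corrupted channels during the execution `T`. -/
def Adversary.view (A : Adversary M Msg n t) (rA : A.Coin) (T : List (Exchange n Msg)) :
    List (Glimpse n Msg) :=
  T.map fun e => glimpse (A.corrupt rA) e.sent

/-- What arrives when `x` is sent after the execution `T` of the earlier rounds. -/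
def Adversary.deliver (A : Adversary M Msg n t) (rA : A.Coin) (T : List (Exchange n Msg))
    (x : Row n Msg) : Row n Msg :=
  fun i => if i ∈ A.corrupt rA then
    A.tamper rA (A.view rA T ++ [glimpse (A.corrupt rA) x]) i else x i

/-- The first `k` rounds of the execution on message `m` with the given random coins, in
chronological order. -/
def run (P : Protocol M Msg n) (A : Adversary M Msg n t) (m : M) (rS : P.SCoin) (rR : P.RCoin)
    (rA : A.Coin) : ℕ → List (Exchange n Msg)
  | 0 => []
  | k + 1 =>
    let T := run P A m rS rR rA k
    let x := P.send m rS rR k T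
    T ++ [⟨P.speaker k, x, A.deliver rA T x⟩]

/-- The complete execution. -/
def exec (P : Protocol M Msg n) (A : Adversary M Msg n t) (m : M) (rS : P.SCoin) (rR : P.RCoin)
    (rA : A.Coin) : List (Exchange n Msg) :=
  run P A m rS rR rA P.rounds

/-- The receiver's output `M_R`. -/
def received (P : Protocol M Msg n) (A : Adversary M Msg n t) (m : M) (rS : P.SCoin)
    (rR : P.RCoin) (rA : A.Coin) : Option M :=
  P.output rR (heard .receiver (exec P A m rS rR rA))

/-- The adversary's output `M_A`. -/
def guessed (P : Protocol M Msg n) (A : Adversary M Msg n t) (m : M) (rS : P.SCoin)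
    (rR : P.RCoin) (rA : A.Coin) : M :=
  A.guess rA (A.view rA (exec P A m rS rR rA))

/-- Some honest party sends the special message "DETECT" during the execution. -/
def Detected (P : Protocol M Msg n) (A : Adversary M Msg n t) (m : M) (rS : P.SCoin)
    (rR : P.RCoin) (rA : A.Coin) : Prop :=
  ∃ e ∈ exec P A m rS rR rA, ∃ i, (e.sent i).detect = true

/-- The distribution of the adversary's view `V_A(m, r_A)`, for fixed coins of the adversary, over
the coins of the sender and the receiver. -/
noncomputable def viewDist (P : Protocol M Msg n) (A : Adversary M Msg n t) (m : M)
    (rA : A.Coin) : PMF (List (Glimpse n Msg)) :=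
  P.sCoin.bind fun rS => P.rCoin.bind fun rR => PMF.pure (A.view rA (exec P A m rS rR rA))

/-- The distribution of the receiver's output when the message `m` is sent, over the coins of the
sender, the receiver and the adversary. -/
noncomputable def outputDist (P : Protocol M Msg n) (A : Adversary M Msg n t) (m : M) :
    PMF (Option M) :=
  P.sCoin.bind fun rS => P.rCoin.bind fun rR => A.coin.bind fun rA =>
    PMF.pure (received P A m rS rR rA)

end Execution

/-- The statistical distance of two discrete distributions. -/
noncomputable def statDist {Ω : Type} (p q : PMF Ω) : ℝ :=
  (1 / 2) * ∑' ω, |(p ω).toReal - (q ω).toReal|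

/-- `P` is `(ε, δ)`-SMT against the adversary `A`. -/
structure IsSMTAgainst {M Msg : Type} {n t : ℕ} (P : Protocol M Msg n)
    (A : Adversary M Msg n t) (ε δ : ℝ) : Prop where
  /-- If `A` does not change the messages on the corrupted channels, the message arrives. -/
  correctness : ∀ m, (∀ rS rR rA, ∀ e ∈ exec P A m rS rR rA, e.delivered = e.sent) →
    outputDist P A m (some m) = 1
  privacy : ∀ m₀ m₁ rA, statDist (viewDist P A m₀ rA) (viewDist P A m₁ rA) ≤ ε
  reliability : ∀ m, ((outputDist P A m).toOuterMeasure {x | x ≠ some m}).toReal ≤ δ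

/-- Outcomes of the SMT game. -/
structure Outcome where
  guess : Bool
  suc : Bool
  detect : Bool
  deriving DecidableEq, Fintype

open Classical in
/-- The SMT game: a uniformly random message is transmitted in the presence of `A`. -/
noncomputable def game {M Msg : Type} [Fintype M] [Nonempty M] {n t : ℕ} (P : Protocol M Msg n)
    (A : Adversary M Msg n t) : PMF Outcome :=
  (PMF.uniformOfFintype M).bind fun m =>
    P.sCoin.bind fun rS => P.rCoin.bind fun rR => A.coin.bind fun rA =>
      PMF.pure
        { guess := decide (guessed P A m rS rR rA = m)
          suc := decide (received P A m rS rR rA = some m)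
          detect := decide (Detected P A m rS rR rA) }

/-- The utility `u(A, U)`: the expected value of `U` at the outcome of the SMT game. -/
noncomputable def utility {M Msg : Type} [Fintype M] [Nonempty M] {n t : ℕ}
    (P : Protocol M Msg n) (A : Adversary M Msg n t) (U : Outcome → ℝ) : ℝ :=
  ∑ o : Outcome, (game P A o).toReal * U o

/-- `P` is perfectly secure against a rational `t`-adversary with utility function `U`. -/
def PerfectlySecureAgainstRational {M Msg : Type} [Fintype M] [Nonempty M] {n : ℕ}
    (P : Protocol M Msg n) (t : ℕ) (U : Outcome → ℝ) : Prop :=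
  ∃ B : Adversary M Msg n t, IsSMTAgainst P B 0 0 ∧
    ∀ A : Adversary M Msg n t, utility P A U ≤ utility P B U

/-- The utility functions of timid adversaries (`false < true` in `Bool`). -/
structure IsTimid (U : Outcome → ℝ) : Prop where
  prefers_failure : ∀ o o' : Outcome,
    o.guess = o'.guess → o.suc < o'.suc → o.detect = o'.detect → U o' < U o
  prefers_undetected : ∀ o o' : Outcome,
    o.guess = o'.guess → o.suc = o'.suc → o.detect < o'.detect → U o' < U o

/-- The expected utility when `Pr[guess = 1] = 1 / |M|` and `suc`, `detect` are fixed. -/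
noncomputable def utilityAt (M : Type) [Fintype M] (U : Outcome → ℝ) (suc detect : Bool) : ℝ :=
  (1 / (Fintype.card M : ℝ)) * U ⟨true, suc, detect⟩
    + (1 - 1 / (Fintype.card M : ℝ)) * U ⟨false, suc, detect⟩

/-- Utility when the receiver gets the message and nothing is detected. -/
noncomputable def u₂ (M : Type) [Fintype M] (U : Outcome → ℝ) : ℝ := utilityAt M U true false

/-- Utility when the receiver does not get the message and tampering is detected. -/
noncomputable def u₃ (M : Type) [Fintype M] (U : Outcome → ℝ) : ℝ := utilityAt M U false true

/-- Utility when the receiver gets the message and tampering is detected. -/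
noncomputable def u₄ (M : Type) [Fintype M] (U : Outcome → ℝ) : ℝ := utilityAt M U true true

end SMT

/-!
Suppose `n ≤ 2 t`, so that the channels split into two sides of at most `t` channels each. Let the
adversary corrupt a random side, run the sender's program there on a random message of its own with
fresh coins, and block the traffic towards the sender. Exchanging the true sender with the
impersonated one, and at the same time the two sides, preserves the distribution of all coins and
everything the receiver hears. In two executions exchanged in this way the receiver produces the
same output, so that both can only succeed if the two messages agree. Hence transmission succeeds
with probability at most `(1 + 1 / |M|) / 2`. If in addition the adversary ends with a blind guess,
its utility is at least `(1 - 1 / |M|) / 2 * u₃`, while an adversary against which the protocol is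
`(0, 0)`-SMT never gets more than `u₂`.
-/

namespace SMT

open scoped ENNReal

section DiscreteDistributions

variable {α β : Type*}

/-- The expected value of a real function on a finite type. -/
noncomputable def expect [Fintype α] (p : PMF α) (f : α → ℝ) : ℝ := ∑ a, (p a).toReal * f a

theorem expect_pure [Fintype α] (a : α) (f : α → ℝ) : expect (PMF.pure a) f = f a := by
  classical
  simp [expect, PMF.pure_apply, apply_ite ENNReal.toReal]

theorem expect_bind [Fintype α] [Fintype β] (p : PMF α) (q : α → PMF β) (f : β → ℝ) :
    expect (p.bind q) f = expect p fun a => expect (q a) f := by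
  have toReal_bind (b : β) : (p.bind q b).toReal = ∑ a, (p a).toReal * (q a b).toReal := by
    rw [PMF.bind_apply, tsum_fintype, ENNReal.toReal_sum fun a _ =>
      ENNReal.mul_ne_top (p.apply_ne_top a) ((q a).apply_ne_top b)]
    simp only [ENNReal.toReal_mul]
  simp only [expect, toReal_bind, Finset.sum_mul, Finset.mul_sum]
  rw [Finset.sum_comm]
  simp only [mul_assoc]

theorem expect_map [Fintype α] [Fintype β] (p : PMF α) (g : α → β) (f : β → ℝ) :
    expect (p.map g) f = expect p fun a => f (g a) := by
  simp only [← PMF.bind_pure_comp, expect_bind, Function.comp_apply, expect_pure]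

theorem expect_mono [Fintype α] {p : PMF α} {f g : α → ℝ} (h : ∀ a ∈ p.support, f a ≤ g a) :
    expect p f ≤ expect p g := by
  refine Finset.sum_le_sum fun a _ => ?_
  by_cases ha : a ∈ p.support
  · exact mul_le_mul_of_nonneg_left (h a ha) ENNReal.toReal_nonneg
  · simp [(p.apply_eq_zero_iff a).2 ha]

theorem apply_true_add_apply_false (p : PMF Bool) : p true + p false = 1 := by
  rw [← Fintype.sum_bool, ← tsum_fintype (L := .unconditional _), p.tsum_coe]

theorem expect_bool (p : PMF Bool) (f : Bool → ℝ) :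
    expect p f = (p true).toReal * f true + (1 - (p true).toReal) * f false := by
  have hp : (p true).toReal + (p false).toReal = 1 := by
    rw [← ENNReal.toReal_add (p.apply_ne_top _) (p.apply_ne_top _), apply_true_add_apply_false,
      ENNReal.toReal_one]
  rw [← hp, expect, Fintype.sum_bool, add_sub_cancel_left]

theorem eq_of_apply_true_eq {p q : PMF Bool} (h : p true = q true) : p = q := by
  refine PMF.ext (Bool.forall_bool.2 ⟨?_, h⟩)
  rw [← ENNReal.add_right_inj (p.apply_ne_top true), apply_true_add_apply_false, h,
    apply_true_add_apply_false]

theorem map_decide_apply_true (p : PMF α) (E : α → Prop) [DecidablePred E] :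
    p.map (fun a => decide (E a)) true = p.toOuterMeasure {a | E a} := by
  rw [← PMF.toOuterMeasure_apply_singleton, PMF.toOuterMeasure_map_apply]
  simp only [Set.preimage, Set.mem_singleton_iff, decide_eq_true_eq]

theorem toOuterMeasure_ne_top (p : PMF α) (E : Set α) : p.toOuterMeasure E ≠ ∞ := by
  rw [PMF.toOuterMeasure_apply]
  exact p.tsum_coe_indicator_ne_top E

theorem eq_of_statDist_le_zero {Ω : Type} {p q : PMF Ω} (h : statDist p q ≤ 0) : p = q := by
  have summable_toReal (r : PMF Ω) : Summable fun a => (r a).toReal :=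
    ENNReal.summable_toReal r.tsum_coe_ne_top
  have summable_dist : Summable fun a => |(p a).toReal - (q a).toReal| :=
    ((summable_toReal p).sub (summable_toReal q)).abs
  have tsum_eq_zero : ∑' a, |(p a).toReal - (q a).toReal| = 0 :=
    le_antisymm (by unfold statDist at h; linarith) (tsum_nonneg fun a => abs_nonneg _)
  have dist_eq_zero := (hasSum_zero_iff_of_nonneg fun a => abs_nonneg _).1
    (tsum_eq_zero ▸ summable_dist.hasSum)
  refine PMF.ext fun a => ?_
  rw [← ENNReal.toReal_eq_toReal_iff' (p.apply_ne_top a) (q.apply_ne_top a), ← sub_eq_zero,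
    ← abs_eq_zero]
  exact congrFun dist_eq_zero a

theorem two_mul_toOuterMeasure_le_of_map_eq {p : PMF α} {σ : α → α} (hσ : p.map σ = p)
    (E : Set α) : 2 * p.toOuterMeasure E ≤ 1 + p.toOuterMeasure (E ∩ σ ⁻¹' E) := by
  let _ : MeasurableSpace α := ⊤
  have measure_preimage : p.toOuterMeasure (σ ⁻¹' E) = p.toOuterMeasure E := by
    rw [← PMF.toOuterMeasure_map_apply, hσ]
  simp only [← PMF.toMeasure_apply_eq_toOuterMeasure] at measure_preimage ⊢
  calc 2 * p.toMeasure E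
      = p.toMeasure E + p.toMeasure (σ ⁻¹' E) := by rw [measure_preimage, two_mul]
    _ = p.toMeasure (E ∪ σ ⁻¹' E) + p.toMeasure (E ∩ σ ⁻¹' E) :=
        (MeasureTheory.measure_union_add_inter E MeasurableSpace.measurableSet_top).symm
    _ ≤ 1 + p.toMeasure (E ∩ σ ⁻¹' E) := by
        gcongr
        exact MeasureTheory.prob_le_one

theorem map_equiv_uniformOfFintype [Fintype α] [Nonempty α] [Fintype β] [Nonempty β]
    (e : α ≃ β) : (PMF.uniformOfFintype α).map e = PMF.uniformOfFintype β := by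
  classical
  refine PMF.ext fun b => ?_
  rw [PMF.map_apply, tsum_eq_single (e.symm b)]
  · simp [Fintype.card_congr e]
  · rintro a ha
    exact if_neg fun hb => ha (e.eq_symm_apply.2 hb.symm)

end DiscreteDistributions

section BlindGuess

variable (M : Type) [Fintype M] [Nonempty M]

open Classical in
/-- The distribution of the correctness of a guess at a uniformly random message which is made
without any information. It does not depend on the guess, see `map_decide_eq_uniformOfFintype`; an
arbitrary one is used to define it. -/
noncomputable def blindGuess : PMF Bool :=
  (PMF.uniformOfFintype M).map fun m => decide (m = Classical.arbitrary M)

variable {M}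

theorem map_decide_eq_uniformOfFintype_apply_true [DecidableEq M] (g : M) :
    (PMF.uniformOfFintype M).map (fun m => decide (m = g)) true = (Fintype.card M : ℝ≥0∞)⁻¹ := by
  rw [map_decide_apply_true]
  simp

theorem blindGuess_apply_true : blindGuess M true = (Fintype.card M : ℝ≥0∞)⁻¹ :=
  open Classical in map_decide_eq_uniformOfFintype_apply_true _

theorem map_decide_eq_uniformOfFintype [DecidableEq M] (g : M) :
    (PMF.uniformOfFintype M).map (fun m => decide (m = g)) = blindGuess M :=
  eq_of_apply_true_eq
    ((map_decide_eq_uniformOfFintype_apply_true g).trans blindGuess_apply_true.symm)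

theorem map_decide_eq_uniformOfFintype' [DecidableEq M] (m : M) :
    (PMF.uniformOfFintype M).map (fun g => decide (m = g)) = blindGuess M := by
  simpa only [eq_comm] using map_decide_eq_uniformOfFintype m

theorem utilityAt_eq_expect (U : Outcome → ℝ) (s d : Bool) :
    utilityAt M U s d = expect (blindGuess M) fun g => U ⟨g, s, d⟩ := by
  rw [expect_bool, blindGuess_apply_true, ENNReal.toReal_inv, ENNReal.toReal_natCast, utilityAt,
    one_div]

theorem utilityAt_mono {U : Outcome → ℝ} {s d s' d' : Bool}
    (h : ∀ g, U ⟨g, s, d⟩ ≤ U ⟨g, s', d'⟩) : utilityAt M U s d ≤ utilityAt M U s' d' := by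
  simp only [utilityAt_eq_expect]
  exact expect_mono fun g _ => h g

end BlindGuess

section Timid

variable {U : Outcome → ℝ}

theorem IsTimid.le_undetected (hU : IsTimid U) (g s d : Bool) : U ⟨g, s, d⟩ ≤ U ⟨g, s, false⟩ := by
  cases d
  · exact le_rfl
  · exact (hU.prefers_undetected ⟨g, s, false⟩ ⟨g, s, true⟩ rfl rfl Bool.false_lt_true).le

theorem IsTimid.detected_le (hU : IsTimid U) (g s d : Bool) : U ⟨g, s, true⟩ ≤ U ⟨g, s, d⟩ := by
  cases d
  · exact hU.le_undetected g s true
  · exact le_rfl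

theorem IsTimid.suc_le_failure (hU : IsTimid U) (g d : Bool) :
    U ⟨g, true, d⟩ ≤ U ⟨g, false, d⟩ :=
  (hU.prefers_failure ⟨g, false, d⟩ ⟨g, true, d⟩ rfl Bool.false_lt_true rfl).le

theorem IsTimid.u₄_le_u₃ {M : Type} [Fintype M] [Nonempty M] (hU : IsTimid U) :
    u₄ M U ≤ u₃ M U :=
  utilityAt_mono fun g => hU.suc_le_failure g true

theorem IsTimid.u₃_of_failure_le_utilityAt {M : Type} [Fintype M] [Nonempty M] (hU : IsTimid U)
    (hU₄ : 0 ≤ u₄ M U) (s d : Bool) : (if s then 0 else u₃ M U) ≤ utilityAt M U s d := by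
  cases s
  · exact utilityAt_mono fun g => hU.detected_le g false d
  · exact hU₄.trans (utilityAt_mono fun g => hU.detected_le g true d)

end Timid

section Game

variable {M Msg : Type} [Fintype M] [Nonempty M] {n t : ℕ}
  {P : Protocol M Msg n} {A : Adversary M Msg n t}

theorem utility_eq_expect (P : Protocol M Msg n) (A : Adversary M Msg n t) (U : Outcome → ℝ) :
    utility P A U = expect (game P A) U := rfl

theorem map_guess_game_of_private
    (hA : ∀ m₀ m₁ rA, statDist (viewDist P A m₀ rA) (viewDist P A m₁ rA) ≤ 0) :
    (game P A).map Outcome.guess = blindGuess M := by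
  classical
  let m₀ : M := Classical.arbitrary M
  have guess_from_view (m : M) : (P.sCoin.bind fun rS => P.rCoin.bind fun rR =>
      A.coin.bind fun rA => PMF.pure (decide (guessed P A m rS rR rA = m)))
      = A.coin.bind fun rA => (viewDist P A m₀ rA).bind fun V =>
          PMF.pure (decide (A.guess rA V = m)) := by
    simp only [eq_of_statDist_le_zero (hA m₀ m _), PMF.bind_comm _ A.coin]
    simp only [viewDist, PMF.bind_bind, PMF.pure_bind]
    rfl
  simp only [game, PMF.map_bind, PMF.pure_map]
  calc (PMF.uniformOfFintype M).bind (fun m => P.sCoin.bind fun rS => P.rCoin.bind fun rR =>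
        A.coin.bind fun rA => PMF.pure (decide (guessed P A m rS rR rA = m)))
      = A.coin.bind fun rA => (viewDist P A m₀ rA).bind fun V =>
          (PMF.uniformOfFintype M).map fun m => decide (A.guess rA V = m) := by
        simp only [guess_from_view, PMF.bind_comm (PMF.uniformOfFintype M), ← PMF.bind_pure_comp]
        rfl
    _ = blindGuess M := by simp only [map_decide_eq_uniformOfFintype', PMF.bind_const]

theorem suc_of_mem_support_game_of_reliable
    (hA : ∀ m, ((outputDist P A m).toOuterMeasure {x | x ≠ some m}).toReal ≤ 0)
    {o : Outcome} (ho : o ∈ (game P A).support) : o.suc = true := by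
  classical
  simp only [game, PMF.mem_support_bind_iff, PMF.mem_support_pure_iff] at ho
  obtain ⟨m, -, rS, hS, rR, hR, rA, hrA, rfl⟩ := ho
  have failure_null : (outputDist P A m).toOuterMeasure {x | x ≠ some m} = 0 :=
    ((ENNReal.toReal_eq_zero_iff _).1 (le_antisymm (hA m) ENNReal.toReal_nonneg)).resolve_right
      (toOuterMeasure_ne_top _ _)
  have received_possible : received P A m rS rR rA ∈ (outputDist P A m).support := by
    simp only [outputDist, PMF.mem_support_bind_iff, PMF.mem_support_pure_iff]
    exact ⟨rS, hS, rR, hR, rA, hrA, rfl⟩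
  rw [PMF.toOuterMeasure_apply_eq_zero_iff, Set.disjoint_left] at failure_null
  exact decide_eq_true (of_not_not (failure_null received_possible))

theorem utility_le_u₂_of_isSMTAgainst {U : Outcome → ℝ} (hU : IsTimid U)
    (hA : IsSMTAgainst P A 0 0) : utility P A U ≤ u₂ M U := by
  calc utility P A U
      ≤ expect (game P A) fun o => U ⟨o.guess, true, false⟩ := by
        refine expect_mono fun o ho => ?_
        rw [← suc_of_mem_support_game_of_reliable hA.reliability ho]
        exact hU.le_undetected o.guess o.suc o.detect
    _ = expect ((game P A).map Outcome.guess) fun g => U ⟨g, true, false⟩ :=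
        (expect_map (game P A) Outcome.guess fun g => U ⟨g, true, false⟩).symm
    _ = u₂ M U := by rw [map_guess_game_of_private hA.privacy, u₂, utilityAt_eq_expect]

end Game

section BlindAdversary

variable {M Msg : Type} [Fintype M] [Nonempty M] {n t : ℕ}

/-- The adversary which acts on the channels like `A` but outputs a uniformly random message,
drawn independently of all else. -/
noncomputable def Adversary.blind (A : Adversary M Msg n t) : Adversary M Msg n t where
  Coin := A.Coin × M
  coin := A.coin.bind fun rA => (PMF.uniformOfFintype M).map fun g => (rA, g)
  corrupt r := A.corrupt r.1
  card_corrupt_le r := A.card_corrupt_le r.1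
  tamper r := A.tamper r.1
  guess r _ := r.2

variable (P : Protocol M Msg n) (A : Adversary M Msg n t)

theorem run_blind (m : M) (rS : P.SCoin) (rR : P.RCoin) (rA : A.Coin) (g : M) (k : ℕ) :
    run P A.blind m rS rR (rA, g) k = run P A m rS rR rA k := by
  induction k with
  | zero => rfl
  | succ k ih => simp only [run, ih]; rfl

theorem game_blind :
    game P A.blind = (game P A).bind fun o =>
      (blindGuess M).map fun g => ⟨g, o.suc, o.detect⟩ := by
  classical
  have bind_coin_blind {γ : Type} (f : A.blind.Coin → PMF γ) : A.blind.coin.bind f =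
      A.coin.bind fun rA => (PMF.uniformOfFintype M).bind fun g => f (rA, g) :=
    (PMF.bind_bind _ _ _).trans (congrArg _ (funext fun _ => PMF.bind_map _ _ _))
  have draw_guess (m : M) (s d : Bool) : (PMF.uniformOfFintype M).bind (fun g =>
      PMF.pure (⟨decide (g = m), s, d⟩ : Outcome)) = (blindGuess M).map fun g => ⟨g, s, d⟩ := by
    rw [← map_decide_eq_uniformOfFintype m, PMF.map_comp]
    rfl
  have guessed_blind (m : M) (rS : P.SCoin) (rR : P.RCoin) (rA : A.Coin) (g : M) :
      guessed P A.blind m rS rR (rA, g) = g := rfl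
  have received_blind (m : M) (rS : P.SCoin) (rR : P.RCoin) (rA : A.Coin) (g : M) :
      received P A.blind m rS rR (rA, g) = received P A m rS rR rA := by
    simp only [received, exec, run_blind]
  have detected_blind (m : M) (rS : P.SCoin) (rR : P.RCoin) (rA : A.Coin) (g : M) :
      Detected P A.blind m rS rR (rA, g) = Detected P A m rS rR rA := by
    simp only [Detected, exec, run_blind]
  simp only [game, PMF.bind_bind, PMF.pure_bind, bind_coin_blind, guessed_blind,
    received_blind, detected_blind, draw_guess]

theorem utility_blind (U : Outcome → ℝ) :
    utility P A.blind U = expect (game P A) fun o => utilityAt M U o.suc o.detect := by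
  simp only [utility_eq_expect, game_blind, expect_bind, expect_map, utilityAt_eq_expect]

theorem failure_mul_u₃_le_utility_blind {U : Outcome → ℝ} (hU : IsTimid U) (hU₄ : 0 ≤ u₄ M U) :
    (1 - ((game P A).map Outcome.suc true).toReal) * u₃ M U ≤ utility P A.blind U := by
  calc (1 - ((game P A).map Outcome.suc true).toReal) * u₃ M U
      = expect ((game P A).map Outcome.suc) fun s => if s then 0 else u₃ M U := by
        simp [expect_bool]
    _ = expect (game P A) fun o => if o.suc then 0 else u₃ M U := expect_map _ _ _
    _ ≤ utility P A.blind U := by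
        rw [utility_blind]
        exact expect_mono fun o _ => hU.u₃_of_failure_le_utilityAt hU₄ o.suc o.detect

end BlindAdversary

section Execution

variable {M Msg : Type} {n t : ℕ}

theorem length_run (P : Protocol M Msg n) (A : Adversary M Msg n t) (m : M) (rS : P.SCoin)
    (rR : P.RCoin) (rA : A.Coin) (k : ℕ) : (run P A m rS rR rA k).length = k := by
  induction k with
  | zero => rfl
  | succ k ih => rw [run, List.length_append, ih, List.length_singleton]

theorem heard_append_of_speaker_eq {p : Party} {e : Exchange n Msg} (he : e.speaker = p)
    (T : List (Exchange n Msg)) : heard p (T ++ [e]) = heard p T := by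
  simp [heard, he]

theorem heard_append_of_speaker_ne {p : Party} {e : Exchange n Msg} (he : e.speaker ≠ p)
    (T : List (Exchange n Msg)) : heard p (T ++ [e]) = heard p T ++ [e.delivered] := by
  simp [heard, he]

theorem Adversary.view_append (A : Adversary M Msg n t) (rA : A.Coin)
    (T : List (Exchange n Msg)) (e : Exchange n Msg) :
    A.view rA (T ++ [e]) = A.view rA T ++ [glimpse (A.corrupt rA) e.sent] :=
  List.map_append

theorem Adversary.length_view (A : Adversary M Msg n t) (rA : A.Coin)
    (T : List (Exchange n Msg)) : (A.view rA T).length = T.length :=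
  List.length_map _

theorem Adversary.deliver_eq_piecewise (A : Adversary M Msg n t) (rA : A.Coin)
    (T : List (Exchange n Msg)) (x : Row n Msg) :
    A.deliver rA T x = (A.corrupt rA).piecewise
      (A.tamper rA (A.view rA T ++ [glimpse (A.corrupt rA) x])) x := rfl

end Execution

section Impersonation

variable {M Msg : Type} {n t : ℕ}

/-- The row in which every channel is blocked. -/
def blankRow : Row n Msg := fun _ => ⟨none, false⟩

/-- What a sender would have heard if, of all that the receiver sent, only the packets seen in `V`
had arrived. -/
def Protocol.overheard (P : Protocol M Msg n) (V : List (Glimpse n Msg)) : List (Row n Msg) :=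
  (V.zipIdx.filter fun g => P.speaker g.2 ≠ .sender).map
    fun g i => (g.1 i).getD (blankRow i)

/-- The contents of the corrupted channels by which an adversary with view `V` impersonates a
sender with message and coins `a`. Traffic towards the true sender is blocked. The last entry of
`V` belongs to the current round, whose number therefore is `V.length - 1`. -/
def Protocol.impersonate (P : Protocol M Msg n) (a : M × P.SCoin) (V : List (Glimpse n Msg)) :
    Row n Msg :=
  match P.speaker (V.length - 1) with
  | .sender => P.sSend a.1 a.2 (V.length - 1) (P.overheard V)
  | .receiver => blankRow

/-- One of the two sides of the partition of the channels into `I` and its complement. -/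
def side (I : Finset (Fin n)) (b : Bool) : Finset (Fin n) := bif b then I else Iᶜ

theorem side_not (I : Finset (Fin n)) (b : Bool) : side I (!b) = (side I b)ᶜ := by
  cases b <;> simp [side]

theorem exists_forall_card_side_le (h : n ≤ 2 * t) :
    ∃ I : Finset (Fin n), ∀ b, (side I b).card ≤ t := by
  obtain ⟨I, -, card_I⟩ := Finset.exists_subset_card_eq
    (s := (Finset.univ : Finset (Fin n))) (n := min t n) (by simp)
  refine ⟨I, Bool.forall_bool.2 ⟨?_, ?_⟩⟩
  · simp only [side, cond_false, Finset.card_compl, Fintype.card_fin, card_I]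
    omega
  · simp only [side, cond_true, card_I, min_le_left]

section Overheard

variable (P : Protocol M Msg n) {V : List (Glimpse n Msg)}

theorem Protocol.overheard_append_of_sender (hV : P.speaker V.length = .sender)
    (g : Glimpse n Msg) : P.overheard (V ++ [g]) = P.overheard V := by
  simp [Protocol.overheard, List.zipIdx_append, hV]

theorem Protocol.overheard_append_of_receiver (hV : P.speaker V.length = .receiver)
    (C : Finset (Fin n)) (x : Row n Msg) :
    P.overheard (V ++ [glimpse C x]) = P.overheard V ++ [C.piecewise x blankRow] := by
  have reveal : (fun i => (glimpse C x i).getD (blankRow i)) = C.piecewise x blankRow := by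
    funext i
    by_cases hi : i ∈ C <;> simp [glimpse, hi]
  simp [Protocol.overheard, List.zipIdx_append, hV, reveal]

theorem Protocol.impersonate_append_of_sender (hV : P.speaker V.length = .sender)
    (a : M × P.SCoin) (g : Glimpse n Msg) :
    P.impersonate a (V ++ [g]) = P.sSend a.1 a.2 V.length (P.overheard V) := by
  simp [Protocol.impersonate, hV, P.overheard_append_of_sender]

theorem Protocol.impersonate_append_of_receiver (hV : P.speaker V.length = .receiver)
    (a : M × P.SCoin) (g : Glimpse n Msg) : P.impersonate a (V ++ [g]) = blankRow := by
  simp [Protocol.impersonate, hV]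

end Overheard

section Rounds

variable {P : Protocol M Msg n} {A : Adversary M Msg n t} {m : M} {rS : P.SCoin} {rR : P.RCoin}
  {rA : A.Coin} {k : ℕ}

theorem speaker_length_view_run : P.speaker (A.view rA (run P A m rS rR rA k)).length
    = P.speaker k := by
  rw [Adversary.length_view, length_run]

theorem heard_sender_run_succ_of_sender (hk : P.speaker k = .sender) :
    heard .sender (run P A m rS rR rA (k + 1)) = heard .sender (run P A m rS rR rA k) :=
  heard_append_of_speaker_eq hk _

theorem heard_receiver_run_succ_of_receiver (hk : P.speaker k = .receiver) :
    heard .receiver (run P A m rS rR rA (k + 1)) = heard .receiver (run P A m rS rR rA k) :=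
  heard_append_of_speaker_eq hk _

theorem heard_receiver_run_succ_of_sender (hk : P.speaker k = .sender) {a : M × P.SCoin}
    (hA : A.tamper rA = P.impersonate a) :
    heard .receiver (run P A m rS rR rA (k + 1)) = heard .receiver (run P A m rS rR rA k) ++
      [(A.corrupt rA).piecewise
        (P.sSend a.1 a.2 k (P.overheard (A.view rA (run P A m rS rR rA k))))
        (P.sSend m rS k (heard .sender (run P A m rS rR rA k)))] := by
  rw [run, heard_append_of_speaker_ne (by simp [hk]), Adversary.deliver_eq_piecewise, hA,
    P.impersonate_append_of_sender (speaker_length_view_run.trans hk), Adversary.length_view,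
    length_run, Protocol.send, hk]

theorem heard_sender_run_succ_of_receiver (hk : P.speaker k = .receiver) {a : M × P.SCoin}
    (hA : A.tamper rA = P.impersonate a) :
    heard .sender (run P A m rS rR rA (k + 1)) = heard .sender (run P A m rS rR rA k) ++
      [(A.corrupt rA).piecewise blankRow
        (P.rSend rR k (heard .receiver (run P A m rS rR rA k)))] := by
  rw [run, heard_append_of_speaker_ne (by simp [hk]), Adversary.deliver_eq_piecewise, hA,
    P.impersonate_append_of_receiver (speaker_length_view_run.trans hk), Protocol.send, hk]

theorem overheard_view_run_succ_of_sender (hk : P.speaker k = .sender) :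
    P.overheard (A.view rA (run P A m rS rR rA (k + 1)))
      = P.overheard (A.view rA (run P A m rS rR rA k)) := by
  rw [run, Adversary.view_append,
    P.overheard_append_of_sender (speaker_length_view_run.trans hk)]

theorem overheard_view_run_succ_of_receiver (hk : P.speaker k = .receiver) :
    P.overheard (A.view rA (run P A m rS rR rA (k + 1)))
      = P.overheard (A.view rA (run P A m rS rR rA k)) ++
        [(A.corrupt rA).piecewise
          (P.rSend rR k (heard .receiver (run P A m rS rR rA k))) blankRow] := by
  rw [run, Adversary.view_append,
    P.overheard_append_of_receiver (speaker_length_view_run.trans hk), Protocol.send, hk]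

end Rounds

section Exchange

variable {P : Protocol M Msg n} {A A' : Adversary M Msg n t} {a a' : M × P.SCoin}
  {rR : P.RCoin} {r : A.Coin} {r' : A'.Coin}

theorem heard_run_of_impersonate_swap (hA : A.tamper r = P.impersonate a')
    (hA' : A'.tamper r' = P.impersonate a) (hC : A'.corrupt r' = (A.corrupt r)ᶜ) (k : ℕ) :
    let T := run P A a.1 a.2 rR r k
    let T' := run P A' a'.1 a'.2 rR r' k
    heard .receiver T = heard .receiver T' ∧ heard .sender T = P.overheard (A'.view r' T') ∧
      heard .sender T' = P.overheard (A.view r T) := by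
  have piecewise_corrupt' (x y : Row n Msg) :
      (A'.corrupt r').piecewise x y = (A.corrupt r).piecewise y x := by
    convert Finset.piecewise_compl (A.corrupt r) x y
  induction k with
  | zero => exact ⟨rfl, rfl, rfl⟩
  | succ k ih =>
    obtain ⟨receiver_eq, sender_eq, sender'_eq⟩ := ih
    cases hk : P.speaker k with
    | sender =>
      simp only [heard_receiver_run_succ_of_sender hk hA,
        heard_receiver_run_succ_of_sender hk hA', heard_sender_run_succ_of_sender hk,
        overheard_view_run_succ_of_sender hk, receiver_eq, sender_eq, sender'_eq,
        piecewise_corrupt', and_self]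
    | receiver =>
      simp only [heard_receiver_run_succ_of_receiver hk, heard_sender_run_succ_of_receiver hk hA,
        heard_sender_run_succ_of_receiver hk hA', overheard_view_run_succ_of_receiver hk,
        receiver_eq, sender_eq, sender'_eq, piecewise_corrupt', and_self]

theorem received_eq_of_impersonate_swap (hA : A.tamper r = P.impersonate a')
    (hA' : A'.tamper r' = P.impersonate a) (hC : A'.corrupt r' = (A.corrupt r)ᶜ) :
    received P A a.1 a.2 rR r = received P A' a'.1 a'.2 rR r' :=
  congrArg (P.output rR) (heard_run_of_impersonate_swap hA hA' hC P.rounds).1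

end Exchange

end Impersonation

section SuccessProbability

variable {M Msg : Type} [Fintype M] [Nonempty M] {n t : ℕ}

/-- The distribution of a uniformly random message together with coins of the sender. -/
noncomputable def Protocol.senderCoins (P : Protocol M Msg n) : PMF (M × P.SCoin) :=
  (PMF.uniformOfFintype M).bind fun m => P.sCoin.map fun rS => (m, rS)

/-- The adversary which corrupts a random side of a partition of the channels and impersonates
there a sender of a random message. Its own output is an arbitrary choice. -/
noncomputable def impersonator (P : Protocol M Msg n) {I : Finset (Fin n)}
    (hI : ∀ b, (side I b).card ≤ t) : Adversary M Msg n t where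
  Coin := (M × P.SCoin) × Bool
  coin := P.senderCoins.bind fun a => (PMF.uniformOfFintype Bool).map fun b => (a, b)
  corrupt r := side I r.2
  card_corrupt_le r := hI r.2
  tamper r := P.impersonate r.1
  guess r _ := r.1.1

variable (P : Protocol M Msg n) {I : Finset (Fin n)} (hI : ∀ b, (side I b).card ≤ t)

theorem received_impersonator_swap (rR : P.RCoin) (a a' : M × P.SCoin) (b : Bool) :
    received P (impersonator P hI) a.1 a.2 rR (a', b)
      = received P (impersonator P hI) a'.1 a'.2 rR (a, !b) :=
  received_eq_of_impersonate_swap rfl rfl (side_not I b)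

/-- The distribution of all that is drawn in the SMT game with the impersonator: message and coins
of the sender, coins of the receiver, message and coins of the impersonated sender, and the
corrupted side. -/
noncomputable def impersonationCoins : PMF ((M × P.SCoin) × P.RCoin × (M × P.SCoin) × Bool) :=
  P.senderCoins.bind fun a => P.rCoin.bind fun rR => P.senderCoins.bind fun a' =>
    (PMF.uniformOfFintype Bool).map fun b => (a, rR, a', b)

theorem map_suc_game_impersonator_apply_true :
    (game P (impersonator P hI)).map Outcome.suc true = (impersonationCoins P).toOuterMeasure
      {ω | received P (impersonator P hI) ω.1.1 ω.1.2 ω.2.1 ω.2.2 = some ω.1.1} := by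
  classical
  have bind_coin {γ : Type} (f : (impersonator P hI).Coin → PMF γ) :
      (impersonator P hI).coin.bind f =
        P.senderCoins.bind fun a' => (PMF.uniformOfFintype Bool).bind fun b => f (a', b) :=
    (PMF.bind_bind _ _ _).trans (congrArg _ (funext fun _ => PMF.bind_map _ _ _))
  rw [← map_decide_apply_true]
  congr 1
  simp only [game, impersonationCoins, Protocol.senderCoins, bind_coin, ← PMF.bind_pure_comp,
    PMF.bind_bind, PMF.pure_bind, Function.comp_def]

/-- The exchange of the true sender with the impersonated one, and of the two sides. -/
def swapSenders {P : Protocol M Msg n} (ω : (M × P.SCoin) × P.RCoin × (M × P.SCoin) × Bool) :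
    (M × P.SCoin) × P.RCoin × (M × P.SCoin) × Bool :=
  (ω.2.2.1, ω.2.1, ω.1, !ω.2.2.2)

theorem map_swapSenders_impersonationCoins :
    (impersonationCoins P).map swapSenders = impersonationCoins P := by
  have map_not : (PMF.uniformOfFintype Bool).map (!·) = PMF.uniformOfFintype Bool :=
    map_equiv_uniformOfFintype Equiv.boolNot
  calc (impersonationCoins P).map swapSenders
      = P.senderCoins.bind fun a => P.rCoin.bind fun rR => P.senderCoins.bind fun a' =>
          ((PMF.uniformOfFintype Bool).map (!·)).map fun b => (a', rR, a, b) := by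
        simp only [impersonationCoins, PMF.map_bind, PMF.map_comp]
        rfl
    _ = impersonationCoins P := by
        rw [map_not]
        simp only [PMF.bind_comm P.senderCoins P.rCoin, impersonationCoins]
        exact congrArg _ (funext fun rR => PMF.bind_comm _ _ _)

theorem impersonationCoins_messages_eq :
    (impersonationCoins P).toOuterMeasure {ω | ω.1.1 = ω.2.2.1.1}
      = (Fintype.card M : ℝ≥0∞)⁻¹ := by
  classical
  have map_message : P.senderCoins.map Prod.fst = PMF.uniformOfFintype M := by
    simp only [Protocol.senderCoins, ← PMF.bind_pure_comp, PMF.bind_bind, PMF.pure_bind,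
      Function.comp_apply, PMF.bind_const, PMF.bind_pure]
  rw [← map_decide_apply_true, ← blindGuess_apply_true]
  congr 1
  calc (impersonationCoins P).map (fun ω => decide (ω.1.1 = ω.2.2.1.1))
      = P.senderCoins.bind fun a => P.rCoin.bind fun _ => P.senderCoins.bind fun a' =>
          (PMF.uniformOfFintype Bool).map (Function.const Bool (decide (a.1 = a'.1))) := by
        simp only [impersonationCoins, PMF.map_bind, PMF.map_comp]
        rfl
    _ = P.senderCoins.bind fun a =>
          (P.senderCoins.map Prod.fst).map fun m => decide (a.1 = m) := by
        simp only [PMF.map_const, PMF.bind_const, PMF.map_comp]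
        rfl
    _ = blindGuess M := by
        simp only [map_message, map_decide_eq_uniformOfFintype', PMF.bind_const]

theorem two_mul_map_suc_game_impersonator_le :
    2 * (game P (impersonator P hI)).map Outcome.suc true ≤ 1 + (Fintype.card M : ℝ≥0∞)⁻¹ := by
  rw [map_suc_game_impersonator_apply_true, ← impersonationCoins_messages_eq P]
  refine (two_mul_toOuterMeasure_le_of_map_eq (map_swapSenders_impersonationCoins P) _).trans ?_
  gcongr
  rintro ⟨a, rR, a', b⟩ ⟨suc, suc'⟩
  exact Option.some.inj (suc.symm.trans ((received_impersonator_swap P hI rR a a' b).trans suc'))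

theorem le_utility_blind_impersonator {U : Outcome → ℝ} (hU : IsTimid U) (hU₄ : 0 ≤ u₄ M U) :
    (1 / 2) * (1 - 1 / (Fintype.card M : ℝ)) * u₃ M U
      ≤ utility P (impersonator P hI).blind U := by
  have suc_le := ENNReal.toReal_mono (by simp) (two_mul_map_suc_game_impersonator_le P hI)
  rw [ENNReal.toReal_mul, ENNReal.toReal_add (by simp) (by simp), ENNReal.toReal_inv] at suc_le
  simp only [ENNReal.toReal_ofNat, ENNReal.toReal_one, ENNReal.toReal_natCast] at suc_le
  refine le_trans ?_ (failure_mul_u₃_le_utility_blind P _ hU hU₄)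
  refine mul_le_mul_of_nonneg_right ?_ (hU₄.trans hU.u₄_le_u₃)
  rw [one_div (Fintype.card M : ℝ)]
  linarith

end SuccessProbability

end SMT

theorem mainTheorem3 {M Msg : Type} [Fintype M] [Nonempty M] {n t : ℕ}
    (P : SMT.Protocol M Msg n) (U : SMT.Outcome → ℝ) (hU : SMT.IsTimid U)
    (hU₄ : 0 ≤ SMT.u₄ M U)
    (hP : SMT.PerfectlySecureAgainstRational P t U)
    (hu : SMT.u₂ M U < (1 / 2) * (1 - 1 / (Fintype.card M : ℝ)) * SMT.u₃ M U) :
    (t : ℝ) < (n : ℝ) / 2 := by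
  by_contra! le_t
  have n_le : n ≤ 2 * t := by
    rw [← Nat.cast_le (α := ℝ)]
    push_cast
    linarith
  obtain ⟨I, hI⟩ := SMT.exists_forall_card_side_le n_le
  obtain ⟨B, smt_B, best_B⟩ := hP
  have utility_B := SMT.utility_le_u₂_of_isSMTAgainst hU smt_B
  have utility_blind := SMT.le_utility_blind_impersonator P hI hU hU₄
  linarith [best_B (SMT.impersonator P hI).blind]
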